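/- Let $X$ be a complex Banach space, $L(X)$ the algebra of bounded linear operators on $X$, $K(X)$ the ideal of compact operators, and $\Pi:L(X)\to L(X)/K(X)$ the projection onto the Calkin algebra. For $S\in L(E)$ ($E$ a normed space) let $\alpha(S)=\dim N(S)$ and $\beta(S)=\operatorname{codim}R(S)$, each in $\mathbb N\cup\{\infty\}$; $S$ is semi-Fredholm if $R(S)$ is closed and $\alpha(S)<\infty$ or $\beta(S)<\infty$, and then $\operatorname{ind}(S)=\alpha(S)-\beta(S)\in\mathbb Z\cup\{\pm\infty\}$. An element $a$ of a unital ring is quasinilpotent if $1-xa$ is invertible for every $x$ commuting with $a$. An idempotent $P=P^2\in L(X)$ is *associated* to $T\in L(X)$ in the Calkin algebra if $\Pi(P)$ commutes with $\Pi(T)$, $\Pi(P)\Pi(T)$ is quasinilpotent, and $\Pi(T)+\Pi(P)$ (l) has a left inverse commuting with $\Pi(P)$, or (r) has a right inverse commuting with $\Pi(P)$, or (t) is invertible. $T$ is *left* (resp. *right*) *pseudo semi-B-Fredholm* if some idempotent satisfies this with (l) (resp. (r)), and *pseudo semi-B-Fredholm* if it is left or right pseudo semi-B-Fredholm. For an idempotent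 $P\in L(X)$ let $T_2$ be the restriction of $(I-P)T(I-P)$ to an operator on $R(I-P)=N(P)$. **Theorem 4.2.** Let $T\in L(X)$ be a pseudo semi-B-Fredholm operator. Then: 1. For every idempotent $P$ associated to $T$, the operators $T+P$ and $T_2$ are semi-Fredholm and $\operatorname{ind}(T+P)=\operatorname{ind}(T_2)$; this is $-\infty$ if $\beta(T_2)=\infty$ and $+\infty$ if $\alpha(T_2)=\infty$. 2. The index $\mathbf{ind}(T):=\operatorname{ind}(T+P)\in\mathbb Z\cup\{\pm\infty\}$, with $P$ an idempotent associated to $T$, is well defined: such $P$ exist and all of them give the same value. 3. For all sufficiently small $\lambda\in\mathbb C\setminus\{0\}$ the operator $T-\lambda I$ is semi-Fredholm, and $\displaystyle \mathbf{ind}(T)=\lim_{\lambda\to0,\ \lambda\ne0}\operatorname{ind}(T-\lambda I)$ in $[-\infty,\infty]$. -/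

import Mathlib

open Filter Topology

namespace PseudoBFredholm

section Ring

variable {A : Type*} [Ring A]

/-- `a` is left `p`-invertible: `ap = pa` and `a + p` has a left inverse in the commutant
`{x | xp = px}` of `p`. -/
def IsLeftPInvertible (a p : A) : Prop :=
  Commute a p ∧ ∃ b : A, Commute b p ∧ b * (a + p) = 1

/-- `a` is right `p`-invertible: `ap = pa` and `a + p` has a right inverse in the commutant
`{x | xp = px}` of `p`. -/
def IsRightPInvertible (a p : A) : Prop :=
  Commute a p ∧ ∃ b : A, Commute b p ∧ (a + p) * b = 1

/-- `a` is `p`-invertible: `ap = pa` and `a + p` is invertible. -/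
def IsPInvertible (a p : A) : Prop :=
  Commute a p ∧ IsUnit (a + p)

/-- `a` is quasinilpotent: `1 - xa` is invertible for every `x` commuting with `a`. -/
def IsQuasinilpotent (a : A) : Prop :=
  ∀ x : A, Commute x a → IsUnit (1 - x * a)

end Ring

section Index

variable {E : Type*} [NormedAddCommGroup E] [NormedSpace ℂ E]

/-- The nullity `α(T) = dim N(T)`, with value `⊤` if the null space is infinite dimensional. -/
noncomputable def nullity (T : E →L[ℂ] E) : ℕ∞ :=
  Cardinal.toENat (Module.rank ℂ (LinearMap.ker (T : E →ₗ[ℂ] E)))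

/-- The defect `β(T) = codim R(T)`, with value `⊤` if the codimension is infinite. -/
noncomputable def defect (T : E →L[ℂ] E) : ℕ∞ :=
  Cardinal.toENat (Module.rank ℂ (E ⧸ LinearMap.range (T : E →ₗ[ℂ] E)))

def IsUpperSemiFredholm (T : E →L[ℂ] E) : Prop :=
  IsClosed (LinearMap.range (T : E →ₗ[ℂ] E) : Set E) ∧ nullity T ≠ ⊤

def IsLowerSemiFredholm (T : E →L[ℂ] E) : Prop :=
  IsClosed (LinearMap.range (T : E →ₗ[ℂ] E) : Set E) ∧ defect T ≠ ⊤

def IsSemiFredholm (T : E →L[ℂ] E) : Prop :=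
  IsUpperSemiFredholm T ∨ IsLowerSemiFredholm T

/-- The index `α(T) - β(T)` of a semi-Fredholm operator, an integer, `⊤ = +∞` or `⊥ = -∞`.
(The value is meaningful only if `α(T)` and `β(T)` are not both infinite.) -/
noncomputable def index (T : E →L[ℂ] E) : EReal :=
  ((nullity T : ENNReal) : EReal) - ((defect T : ENNReal) : EReal)

end Index

section Calkin

variable (X : Type*) [NormedAddCommGroup X] [NormedSpace ℂ X]

/-- The ideal `K(X)` of compact operators on `X`. -/
def compactIdeal : Ideal (X →L[ℂ] X) where
  carrier := {K | IsCompactOperator K}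
  add_mem' := fun ha hb => IsCompactOperator.add ha hb
  zero_mem' := isCompactOperator_zero
  smul_mem' := fun S _ hK => IsCompactOperator.clm_comp hK S

instance : (compactIdeal X).IsTwoSided where
  mul_mem_of_left S hK := IsCompactOperator.comp_clm hK S

/-- The Calkin algebra `L(X) / K(X)`. -/
abbrev Calkin : Type _ := (X →L[ℂ] X) ⧸ compactIdeal X

variable {X}

/-- The natural projection `Π : L(X) → L(X) / K(X)`. -/
def toCalkin : (X →L[ℂ] X) →+* Calkin X := Ideal.Quotient.mk (compactIdeal X)

/-- `P` is an idempotent of `L(X)` witnessing that `Π(T)` is left generalized Drazin invertible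
in the Calkin algebra. -/
def IsLeftAssociated (T P : X →L[ℂ] X) : Prop :=
  IsIdempotentElem P ∧ Commute (toCalkin P) (toCalkin T) ∧
    IsQuasinilpotent (toCalkin P * toCalkin T) ∧ IsLeftPInvertible (toCalkin T) (toCalkin P)

/-- `P` is an idempotent of `L(X)` witnessing that `Π(T)` is right generalized Drazin invertible
in the Calkin algebra. -/
def IsRightAssociated (T P : X →L[ℂ] X) : Prop :=
  IsIdempotentElem P ∧ Commute (toCalkin P) (toCalkin T) ∧
    IsQuasinilpotent (toCalkin P * toCalkin T) ∧ IsRightPInvertible (toCalkin T) (toCalkin P)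

/-- `P` is an idempotent of `L(X)` witnessing that `Π(T)` is generalized Drazin invertible
in the Calkin algebra. -/
def IsTwoSidedAssociated (T P : X →L[ℂ] X) : Prop :=
  IsIdempotentElem P ∧ Commute (toCalkin P) (toCalkin T) ∧
    IsQuasinilpotent (toCalkin P * toCalkin T) ∧ IsPInvertible (toCalkin T) (toCalkin P)

/-- `P` is an idempotent associated to `T` in the Calkin algebra, in any of the three senses. -/
def IsAssociated (T P : X →L[ℂ] X) : Prop :=
  IsLeftAssociated T P ∨ IsRightAssociated T P ∨ IsTwoSidedAssociated T P

/-- `Π(T)` is left generalized Drazin invertible. -/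
def IsLeftPseudoSemiBFredholm (T : X →L[ℂ] X) : Prop := ∃ P, IsLeftAssociated T P

/-- `Π(T)` is right generalized Drazin invertible. -/
def IsRightPseudoSemiBFredholm (T : X →L[ℂ] X) : Prop := ∃ P, IsRightAssociated T P

def IsPseudoSemiBFredholm (T : X →L[ℂ] X) : Prop :=
  IsLeftPseudoSemiBFredholm T ∨ IsRightPseudoSemiBFredholm T

/-- The restriction of `Q T Q` to the range of `Q`, as an operator on the range of `Q`.
For an idempotent `P`, `T₂` is `compression (1 - P) T`, an operator on `R(I - P) = N(P)`. -/
def compression (Q T : X →L[ℂ] X) :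
    LinearMap.range (Q : X →ₗ[ℂ] X) →L[ℂ] LinearMap.range (Q : X →ₗ[ℂ] X) :=
  ((Q * T * Q).comp (LinearMap.range (Q : X →ₗ[ℂ] X)).subtypeL).codRestrict _
    (fun x => ⟨T (Q x), rfl⟩)

end Calkin

end PseudoBFredholm

/-!
For an idempotent `P` associated to `T`, put `Q = 1 - P` and `U = Q T Q + P`. As `Π(P)` and `Π(T)`
commute, `T` is block diagonal with respect to `X = N(P) ⊕ R(P)` modulo the compact operators, and
`U` is the direct sum of `T₂` with the identity of `R(P)`. Hence `U` and `T₂` have the same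
nullity, defect and index, and `Π(U)` inherits a one-sided inverse from `Π(T) + Π(P)`.

Quasinilpotence of `Π(P) Π(T)` makes `1 + z P T P` Fredholm for every `z`, and its index, being
locally constant in `z`, is `0`. The factorizations

* `T + P ≡ U (1 + P T P)`,
* `T - z ≡ (U - z Q) (Q - z P) (1 - z⁻¹ P T P)` for `z ≠ 0`,

valid modulo the compact operators, therefore give `ind (T + P) = ind U = ind T₂` and, for small
`z ≠ 0`, `ind (T - z) = ind (U - z Q) = ind U`. So `ind (T - z)` is eventually constant, with value
`ind (T + P)`, and uniqueness of limits shows that this value does not depend on `P`.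

The index theory this needs rests on two facts: `1 + K` has index zero for `K` compact
(`nonempty_ker_equiv_quotient_range`), and an operator is invertible modulo the compact operators
exactly if its nullity and defect are finite (`isUnit_toCalkin_iff`). An operator that is
one-sided invertible modulo the compact operators thus has index `-∞` (left inverse only), `+∞`
(right inverse only), or a finite index that is additive on products. Comparing products with a
one-sided inverse gives stability under compact and under small perturbations
(`index_eq_of_left`, `index_eq_of_right`).
-/

namespace PseudoBFredholm

/-! ### Compact perturbations of the identity -/

section Riesz

variable {X : Type*} [NormedAddCommGroup X] [NormedSpace ℂ X]

theorem isCompactOperator_of_range_le {F : X →L[ℂ] X} {G : Submodule ℂ X} [FiniteDimensional ℂ G]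
    (h : ∀ x, F x ∈ G) : IsCompactOperator F :=
  ((isCompactOperator_id_iff_finiteDimensional (𝕜 := ℂ) (E := G)).2 inferInstance).comp_clm
    (F.codRestrict G h) |>.clm_comp G.subtypeL

theorem finiteDimensional_ker_one_add {K : X →L[ℂ] X} (hK : IsCompactOperator K) :
    FiniteDimensional ℂ (1 + K).ker := by
  have hk : ∀ x : (1 + K).ker, K x = -x := fun x =>
    eq_neg_of_add_eq_zero_right (show (x : X) + K x = 0 from x.2)
  have h1 : IsCompactOperator (K.comp (1 + K).ker.subtypeL) := hK.comp_clm _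
  have h2 := (h1.codRestrict (V := (1 + K).ker)
    (fun x => (hk x).symm ▸ neg_mem x.2) (1 + K).isClosed_ker).neg
  refine FiniteDimensional.of_isCompactOperator_id ?_
  refine (congrArg IsCompactOperator ?_).mp h2
  funext x
  exact Subtype.ext (by change -(K x) = x; rw [hk, neg_neg])

variable [CompleteSpace X]

/-- An operator with finite dimensional null space and complemented range of finite codimension
is inverted, up to finite rank, by a bounded operator: invert it between a closed complement of
the null space and the range. The complement `G` of the range is kept explicit, so that `G = ⊥`
gives a right inverse of a surjection. -/
theorem exists_pseudoinverse (A : X →L[ℂ] X) [FiniteDimensional ℂ A.ker] {G : Submodule ℂ X}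
    [FiniteDimensional ℂ G] (hG : IsCompl A.range G) :
    ∃ B : X →L[ℂ] X, (∀ x, x - A (B x) ∈ G) ∧ ∀ x, x - B (A x) ∈ A.ker := by
  obtain ⟨p, hp⟩ := Submodule.ClosedComplemented.of_finiteDimensional A.ker
  let M : Submodule ℂ X := p.ker
  have hM : IsClosed (M : Set X) := p.isClosed_ker
  have : CompleteSpace M := hM.completeSpace_coe
  have hdec : ∀ x, x - p x ∈ M := fun x => by
    simp [M, hp]
  have hAp : ∀ x, A (p x) = 0 := fun x => (p x).2
  let g : M →L[ℂ] X := A.comp M.subtypeL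
  have hgr : g.range = A.range := by
    apply le_antisymm
    · rintro _ ⟨x, rfl⟩
      exact ⟨x, rfl⟩
    · rintro _ ⟨x, rfl⟩
      exact ⟨⟨x - p x, hdec x⟩, by simp [g, hAp]⟩
  have hgk : g.ker = ⊥ := by
    rw [LinearMap.ker_eq_bot']
    rintro ⟨x, hx⟩ hgx
    have hx' : p x = 0 := hx
    have := hp ⟨x, hgx⟩
    simp only [hx'] at this
    exact Subtype.ext (congrArg Subtype.val this).symm
  have : CompleteSpace G := FiniteDimensional.complete ℂ G
  let e := ContinuousLinearMap.coprodSubtypeLEquivOfIsCompl g (hgr.symm ▸ hG) hgk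
  have he : ∀ z, e z = A z.1 + z.2 := fun z => rfl
  refine ⟨M.subtypeL.comp ((ContinuousLinearMap.fst ℂ M G).comp (e.symm : X →L[ℂ] M × G)), ?_, ?_⟩
  · intro x
    have h := he (e.symm x)
    rw [e.apply_symm_apply] at h
    have : x - A (e.symm x).1 = (e.symm x).2 := by
      nth_rw 1 [h]; abel
    simp [this]
  · intro x
    have h : e.symm (A x) = (⟨x - p x, hdec x⟩, 0) := by
      rw [ContinuousLinearEquiv.symm_apply_eq, he]
      simp [hAp]
    simp [h]

theorem isUnit_one_add_of_injective {K : X →L[ℂ] X} (hK : IsCompactOperator K)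
    (h : ∀ x, (1 + K) x = 0 → x = 0) : IsUnit (1 + K) := by
  rcases hK.hasEigenvalue_or_mem_resolventSet (μ := (-1 : ℂ)) (by norm_num) with h1 | h1
  · obtain ⟨x, hx⟩ := h1.exists_hasEigenvector
    refine absurd (h x ?_) hx.2
    have := hx.apply_eq_smul
    simp at this
    simp [this]
  · rw [spectrum.mem_resolventSet_iff] at h1
    have := h1.neg
    simpa [add_comm] using this

/-- `1 + K` with `K` compact has index zero. A finite rank operator `F`, zero on a complement of
`N(1 + K)`, is chosen that maps `N(1 + K)` injectively into, or onto, a complement `C` of the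
range, according to which dimension is smaller. Then `1 + K + F` is injective or surjective, hence
invertible by the Fredholm alternative, and so `F` maps `N(1 + K)` isomorphically onto `C`. -/
theorem nonempty_ker_equiv_quotient_range {K : X →L[ℂ] X} (hK : IsCompactOperator K) :
    Nonempty ((1 + K).ker ≃ₗ[ℂ] X ⧸ (1 + K).range) := by
  have := finiteDimensional_ker_one_add hK
  obtain ⟨C, hC⟩ := Submodule.exists_isCompl (1 + K).range
  obtain ⟨p, hp⟩ := Submodule.ClosedComplemented.of_finiteDimensional (1 + K).ker
  let F : ((1 + K).ker →ₗ[ℂ] C) → X →L[ℂ] X := fun j =>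
    (LinearMap.toContinuousLinearMap (C.subtype ∘ₗ j)).comp p
  have hF : ∀ (j : (1 + K).ker →ₗ[ℂ] C) x, F j x = j (p x) := fun j x => rfl
  have hFc : ∀ j : (1 + K).ker →ₗ[ℂ] C, IsCompactOperator (F j) := fun j =>
    isCompactOperator_of_range_le (G := LinearMap.range (C.subtype ∘ₗ j)) fun x => ⟨p x, rfl⟩
  have hzero : ∀ (j : (1 + K).ker →ₗ[ℂ] C) x, (1 + (K + F j)) x = 0 →
      x ∈ (1 + K).ker ∧ j (p x) = 0 := by
    intro j x hx
    have h1 : (1 + K) x + j (p x) = 0 := by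
      rw [← hF, ← hx]; simp [add_assoc]
    have h2 := (Submodule.disjoint_def.1 hC.disjoint) _ ⟨x, rfl⟩ (by
      rw [ContinuousLinearMap.coe_coe, eq_neg_of_add_eq_zero_left h1]; exact neg_mem (j (p x)).2)
    rw [ContinuousLinearMap.coe_coe] at h2
    rw [h2, zero_add] at h1
    exact ⟨h2, Subtype.ext h1⟩
  have hinj : ∀ j : (1 + K).ker →ₗ[ℂ] C, Function.Injective j → IsUnit (1 + (K + F j)) := by
    intro j hj
    refine isUnit_one_add_of_injective (hK.add (hFc j)) fun x hx => ?_
    obtain ⟨h1, h2⟩ := hzero j x hx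
    have h3 : p x = ⟨x, h1⟩ := hp ⟨x, h1⟩
    have h4 : p x = 0 := hj (by rw [h2, map_zero])
    rw [h4] at h3
    exact (congrArg Subtype.val h3).symm
  have hsurj : ∀ j : (1 + K).ker →ₗ[ℂ] C, IsUnit (1 + (K + F j)) → Function.Surjective j := by
    intro j hu y
    obtain ⟨u, hu⟩ := hu
    have h1 : (1 + (K + F j)) ((↑u⁻¹ : X →L[ℂ] X) y) = y := by
      rw [← hu, ← mul_apply_eq_comp, u.mul_inv]; rfl
    set x := (↑u⁻¹ : X →L[ℂ] X) y
    have h2 : (1 + K) x = (y - j (p x) : C) := by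
      rw [Submodule.coe_sub, ← hF, eq_sub_iff_add_eq, ← h1]
      simp [add_assoc]
    have h3 := (Submodule.disjoint_def.1 hC.disjoint) _ ⟨x, rfl⟩
      (by rw [ContinuousLinearMap.coe_coe, h2]; exact Subtype.mem _)
    rw [ContinuousLinearMap.coe_coe, h2] at h3
    exact ⟨p x, (sub_eq_zero.1 (Subtype.ext h3)).symm⟩
  suffices ∃ j : (1 + K).ker →ₗ[ℂ] C, Function.Bijective j by
    obtain ⟨j, hj⟩ := this
    exact ⟨(LinearEquiv.ofBijective j hj).trans
      (Submodule.quotientEquivOfIsCompl _ _ hC).symm⟩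
  rcases le_total (Module.rank ℂ (1 + K).ker) (Module.rank ℂ C) with hle | hle
  · obtain ⟨j, hj⟩ := rank_le_iff_exists_linearMap.1 hle
    exact ⟨j, hj, hsurj j (hinj j hj)⟩
  · obtain ⟨i, hi⟩ := rank_le_iff_exists_linearMap.1 hle
    obtain ⟨j, hj⟩ := i.exists_leftInverse_of_injective (LinearMap.ker_eq_bot.2 hi)
    have hjs : Function.Surjective j := fun y => ⟨i y, LinearMap.congr_fun hj y⟩
    refine ⟨j, ?_, hjs⟩
    have hTs : (1 + (K + F j)).range = ⊤ := by
      rw [LinearMap.range_eq_top]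
      intro y
      obtain ⟨_, ⟨a, rfl⟩, c, hc, rfl⟩ := Submodule.mem_sup.1
        (hC.sup_eq_top ▸ Submodule.mem_top : y ∈ (1 + K).range ⊔ C)
      obtain ⟨n, hn⟩ := hjs ⟨c, hc⟩
      have h1 : p (a - p a + n) = n := by
        rw [map_add, map_sub, hp, hp, sub_self, zero_add]
      have h2 : (1 + K) (a - p a + n) = (1 + K) a := by
        rw [map_add, map_sub, show (1 + K) (p a) = 0 from (p a).2, show (1 + K) n = 0 from n.2]
        abel
      refine ⟨a - p a + n, ?_⟩
      rw [ContinuousLinearMap.coe_coe, ContinuousLinearMap.coe_coe, ← add_assoc,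
        add_apply, h2, hF, h1, hn]
    have := finiteDimensional_ker_one_add (K := K + F j) (hK.add (hFc j))
    obtain ⟨S, hS, -⟩ := exists_pseudoinverse (1 + (K + F j)) (G := ⊥) (hTs ▸ isCompl_top_bot)
    have hTS : (1 + (K + F j)) * S = 1 := by
      ext x
      exact (sub_eq_zero.1 ((Submodule.mem_bot ℂ).1 (hS x))).symm
    -- `S` is again an injective compact perturbation of the identity, so the Fredholm alternative
    -- applies to it and makes the surjection invertible.
    have hSu : IsUnit S := by
      have h1 : S = 1 + -((K + F j) * S) := by
        rw [← hTS]; noncomm_ring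
      rw [h1]
      refine isUnit_one_add_of_injective ((hK.add (hFc j)).comp_clm S).neg fun x hx => ?_
      rw [← h1] at hx
      have := congr($hTS x)
      simpa [hx] using this.symm
    have hTu : IsUnit (1 + (K + F j)) := by
      obtain ⟨u, rfl⟩ := hSu
      rw [← u.isUnit_mul_units, hTS] ; exact isUnit_one
    rw [← LinearMap.ker_eq_bot, LinearMap.ker_eq_bot']
    intro n hn
    have h1 : (1 + (K + F j)) n = 0 := by
      have h2 : (1 + K) (n : X) = 0 := n.2
      have h3 : F j n = 0 := by rw [hF, hp, hn]; rfl
      rw [← add_assoc, add_apply, h2, h3, zero_add]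
    obtain ⟨u, hu⟩ := hTu
    rw [← hu] at h1
    have h2 : ((↑u⁻¹ : X →L[ℂ] X) * (u : X →L[ℂ] X)) n = 0 := by
      rw [mul_apply_eq_comp, h1, map_zero]
    rw [u.inv_mul] at h2
    exact Subtype.ext h2

end Riesz

/-! ### Invertibility in the Calkin algebra, nullity and defect -/

/-- `a` has a left inverse or a right inverse. -/
def HasOneSidedInverse {A : Type*} [Monoid A] (a : A) : Prop :=
  (∃ b, b * a = 1) ∨ ∃ b, a * b = 1

section Atkinson

variable {X : Type*} [NormedAddCommGroup X] [NormedSpace ℂ X]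

theorem toCalkin_eq_zero_iff {K : X →L[ℂ] X} : toCalkin K = 0 ↔ IsCompactOperator K :=
  Ideal.Quotient.eq_zero_iff_mem

theorem toCalkin_surjective : Function.Surjective (toCalkin : (X →L[ℂ] X) →+* Calkin X) :=
  Ideal.Quotient.mk_surjective

theorem exists_eq_one_add_of_toCalkin_eq_one {A : X →L[ℂ] X} (h : toCalkin A = 1) :
    ∃ K : X →L[ℂ] X, IsCompactOperator K ∧ A = 1 + K :=
  ⟨A - 1, toCalkin_eq_zero_iff.1 (by rw [map_sub, h, map_one, sub_self]), by abel⟩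

theorem toCalkin_eq_one_of_finiteDimensional {A : X →L[ℂ] X} {G : Submodule ℂ X}
    [FiniteDimensional ℂ G] (h : ∀ x, x - A x ∈ G) : toCalkin A = 1 := by
  have : toCalkin (1 - A) = 0 := toCalkin_eq_zero_iff.2 (isCompactOperator_of_range_le h)
  rw [map_sub, map_one, sub_eq_zero] at this
  exact this.symm

theorem nullity_ne_top_iff {A : X →L[ℂ] X} : nullity A ≠ ⊤ ↔ FiniteDimensional ℂ A.ker := by
  rw [nullity, Cardinal.toENat_ne_top, Module.rank_lt_aleph0_iff]

theorem defect_ne_top_iff {A : X →L[ℂ] X} :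
    defect A ≠ ⊤ ↔ FiniteDimensional ℂ (X ⧸ A.range) := by
  rw [defect, Cardinal.toENat_ne_top, Module.rank_lt_aleph0_iff]

theorem index_eq_linearMap_index (A : X →L[ℂ] X) [FiniteDimensional ℂ A.ker]
    [FiniteDimensional ℂ (X ⧸ A.range)] :
    index A = ((LinearMap.index (A : X →ₗ[ℂ] X) : ℝ) : EReal) := by
  rw [index, nullity, defect, ← Module.finrank_eq_rank, ← Module.finrank_eq_rank,
    LinearMap.index_eq_finrank_sub]
  have hcast (n : ℕ) : (((n : ℕ∞) : ENNReal) : EReal) = ((n : ℝ) : EReal) := by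
    rw [ENat.toENNReal_coe]; rfl
  simp only [map_natCast, hcast]
  push_cast
  rfl

/-- There is no condition on the nullity, since `⊤ - ⊤ = ⊥` in `EReal`. -/
theorem index_eq_bot {A : X →L[ℂ] X} (h : defect A = ⊤) : index A = ⊥ := by
  simp [index, h]

theorem index_eq_top {A : X →L[ℂ] X} (h : nullity A = ⊤) (h' : defect A ≠ ⊤) : index A = ⊤ := by
  rw [index, h]
  lift defect A to ℕ using h' with d
  simp

theorem finiteDimensional_ker_of_toCalkin_mul_eq_one {A B : X →L[ℂ] X}
    (h : toCalkin B * toCalkin A = 1) : FiniteDimensional ℂ A.ker := by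
  rw [← map_mul] at h
  obtain ⟨K, hK, hBA⟩ := exists_eq_one_add_of_toCalkin_eq_one h
  have := finiteDimensional_ker_one_add hK
  refine Submodule.finiteDimensional_of_le (S₂ := (1 + K).ker) fun x hx => ?_
  have hx : A x = 0 := hx
  change (1 + K) x = 0
  rw [← hBA, mul_apply_eq_comp, hx, map_zero]

theorem linearMap_index_of_isUnit {W : X →L[ℂ] X} (hW : IsUnit W) :
    LinearMap.index W.toLinearMap = 0 := by
  obtain ⟨u, rfl⟩ := hW
  exact (ContinuousLinearEquiv.ofUnit u).toLinearEquiv.index_eq_zero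

variable [CompleteSpace X]

theorem isClosed_range_of_finiteDimensional_quotient (A : X →L[ℂ] X)
    [FiniteDimensional ℂ (X ⧸ A.range)] : IsClosed (A.range : Set X) := by
  obtain ⟨G, hG⟩ := Submodule.exists_isCompl A.range
  have : FiniteDimensional ℂ G := (Submodule.quotientEquivOfIsCompl _ _ hG).finiteDimensional
  have : IsClosed (A.ker : Set X) := A.isClosed_ker
  let g : X ⧸ A.ker →L[ℂ] X := A.ker.liftQL A le_rfl
  have hgr : g.range = A.range := Submodule.range_liftQ _ _ _
  have hgk : g.ker = ⊥ := Submodule.ker_liftQ_eq_bot _ _ _ le_rfl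
  rw [← hgr]
  exact ContinuousLinearMap.closed_complemented_range_of_isCompl_of_ker_eq_bot g G
    (hgr.symm ▸ hG) G.closed_of_finiteDimensional hgk

theorem finiteDimensional_quotient_range_of_toCalkin_mul_eq_one {A B : X →L[ℂ] X}
    (h : toCalkin A * toCalkin B = 1) : FiniteDimensional ℂ (X ⧸ A.range) := by
  rw [← map_mul] at h
  obtain ⟨K, hK, hAB⟩ := exists_eq_one_add_of_toCalkin_eq_one h
  have := finiteDimensional_ker_one_add hK
  obtain ⟨e⟩ := nonempty_ker_equiv_quotient_range hK
  have := e.finiteDimensional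
  have hle : (1 + K).range ≤ A.range := by
    rintro _ ⟨x, rfl⟩
    exact ⟨B x, by simp [← hAB]⟩
  exact Submodule.CoFG.of_le hle this

/-- Atkinson's theorem. -/
theorem isUnit_toCalkin_iff {A : X →L[ℂ] X} : IsUnit (toCalkin A) ↔
    FiniteDimensional ℂ A.ker ∧ FiniteDimensional ℂ (X ⧸ A.range) := by
  constructor
  · rintro ⟨u, hu⟩
    obtain ⟨B, hB⟩ := toCalkin_surjective (↑u⁻¹ : Calkin X)
    exact ⟨finiteDimensional_ker_of_toCalkin_mul_eq_one (by rw [hB, ← hu, u.inv_mul]),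
      finiteDimensional_quotient_range_of_toCalkin_mul_eq_one (by rw [hB, ← hu, u.mul_inv])⟩
  · rintro ⟨_, _⟩
    obtain ⟨G, hG⟩ := Submodule.exists_isCompl A.range
    have : FiniteDimensional ℂ G := (Submodule.quotientEquivOfIsCompl _ _ hG).finiteDimensional
    obtain ⟨B, h1, h2⟩ := exists_pseudoinverse A hG
    refine isUnit_iff_exists.2 ⟨toCalkin B, ?_, ?_⟩ <;> rw [← map_mul]
    exacts [toCalkin_eq_one_of_finiteDimensional h1, toCalkin_eq_one_of_finiteDimensional h2]

/-- After composing with a pseudoinverse of `B A`, `A` has a left inverse `D` on the closed subspace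
`E = N(1 - D A)` of finite codimension. So `A` is bounded below on `E` and `A(E)` is closed. -/
theorem isClosed_range_of_toCalkin_mul_eq_one {A B : X →L[ℂ] X}
    (h : toCalkin B * toCalkin A = 1) : IsClosed (A.range : Set X) := by
  rw [← map_mul] at h
  have hu : IsUnit (toCalkin (B * A)) := h ▸ isUnit_one
  obtain ⟨_, _⟩ := isUnit_toCalkin_iff.1 hu
  obtain ⟨G, hG⟩ := Submodule.exists_isCompl (B * A).range
  have : FiniteDimensional ℂ G := (Submodule.quotientEquivOfIsCompl _ _ hG).finiteDimensional
  obtain ⟨C, -, hC⟩ := exists_pseudoinverse (B * A) hG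
  let D : X →L[ℂ] X := C * B
  let E : Submodule ℂ X := (1 - D * A).ker
  have hE : IsClosed (E : Set X) := (1 - D * A).isClosed_ker
  have hEfin : E.CoFG := by
    refine LinearMap.HasFiniteRange.cofg_ker ?_
    rw [LinearMap.hasFiniteRange_iff_range, Submodule.fg_iff_finiteDimensional]
    refine Submodule.finiteDimensional_of_le (S₂ := (B * A).ker) ?_
    rintro _ ⟨x, rfl⟩
    exact hC x
  refine LinearMap.isClosed_range_of_isClosed_map_of_finiteDimensional_quotient (s := E) ?_
  have : CompleteSpace E := hE.completeSpace_coe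
  have hanti : AntilipschitzWith ‖D‖₊ (A.comp E.subtypeL) := by
    refine AddMonoidHomClass.antilipschitz_of_bound _ fun x => ?_
    have hx : (x : X) - D (A x) = 0 := x.2
    calc ‖x‖ = ‖D (A x)‖ := by rw [← sub_eq_zero.1 hx]; rfl
      _ ≤ _ := D.le_opNorm _
  have := hanti.isClosed_range (A.comp E.subtypeL).uniformContinuous
  convert this using 1
  ext y
  simp

theorem IsSemiFredholm.of_toCalkin {A : X →L[ℂ] X}
    (h : HasOneSidedInverse (toCalkin A)) : IsSemiFredholm A := by
  rcases h with ⟨b, hb⟩ | ⟨b, hb⟩ <;> obtain ⟨B, rfl⟩ := toCalkin_surjective b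
  · exact .inl ⟨isClosed_range_of_toCalkin_mul_eq_one hb,
      nullity_ne_top_iff.2 (finiteDimensional_ker_of_toCalkin_mul_eq_one hb)⟩
  · have := finiteDimensional_quotient_range_of_toCalkin_mul_eq_one hb
    exact .inr ⟨isClosed_range_of_finiteDimensional_quotient A, defect_ne_top_iff.2 this⟩

end Atkinson

/-! ### Stability of the index -/

section Stability

variable {X : Type*} [NormedAddCommGroup X] [NormedSpace ℂ X] [CompleteSpace X]

theorem index_eq_bot_of_left {A : X →L[ℂ] X} (h : ∃ b, b * toCalkin A = 1)
    (hA : ¬ IsUnit (toCalkin A)) : index A = ⊥ := by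
  obtain ⟨b, hb⟩ := h
  obtain ⟨B, rfl⟩ := toCalkin_surjective b
  refine index_eq_bot ?_
  by_contra hd
  exact hA (isUnit_toCalkin_iff.2
    ⟨finiteDimensional_ker_of_toCalkin_mul_eq_one hb, defect_ne_top_iff.1 hd⟩)

theorem index_eq_top_of_right {A : X →L[ℂ] X} (h : ∃ b, toCalkin A * b = 1)
    (hA : ¬ IsUnit (toCalkin A)) : index A = ⊤ := by
  obtain ⟨b, hb⟩ := h
  obtain ⟨B, rfl⟩ := toCalkin_surjective b
  have hd := finiteDimensional_quotient_range_of_toCalkin_mul_eq_one hb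
  refine index_eq_top ?_ (defect_ne_top_iff.2 hd)
  by_contra hn
  exact hA (isUnit_toCalkin_iff.2 ⟨nullity_ne_top_iff.1 hn, hd⟩)

theorem index_eq_linearMap_index_of_isUnit {A : X →L[ℂ] X} (hA : IsUnit (toCalkin A)) :
    index A = ((LinearMap.index (A : X →ₗ[ℂ] X) : ℝ) : EReal) := by
  obtain ⟨_, _⟩ := isUnit_toCalkin_iff.1 hA
  exact index_eq_linearMap_index A

theorem linearMap_index_mul {A B : X →L[ℂ] X} (hA : IsUnit (toCalkin A))
    (hB : IsUnit (toCalkin B)) :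
    LinearMap.index (A * B : X →L[ℂ] X).toLinearMap =
      LinearMap.index A.toLinearMap + LinearMap.index B.toLinearMap := by
  obtain ⟨_, _⟩ := isUnit_toCalkin_iff.1 hA
  obtain ⟨_, _⟩ := isUnit_toCalkin_iff.1 hB
  exact LinearMap.index_comp A.toLinearMap (f := B.toLinearMap)

theorem linearMap_index_one_add {K : X →L[ℂ] X} (hK : IsCompactOperator K) :
    LinearMap.index (1 + K).toLinearMap = 0 := by
  obtain ⟨e⟩ := nonempty_ker_equiv_quotient_range hK
  rw [LinearMap.index_eq_finrank_sub, e.finrank_eq, sub_self]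

theorem linearMap_index_of_toCalkin_eq {A W : X →L[ℂ] X} (hW : IsUnit W)
    (h : toCalkin A = toCalkin W) : LinearMap.index A.toLinearMap = 0 := by
  obtain ⟨u, rfl⟩ := hW
  have h1 : toCalkin ((↑u⁻¹ : X →L[ℂ] X) * A) = 1 := by
    rw [map_mul, h, ← map_mul, u.inv_mul, map_one]
  obtain ⟨K, hK, hA⟩ := exists_eq_one_add_of_toCalkin_eq_one h1
  have h2 : A = u * (1 + K) := by rw [← hA, u.mul_inv_cancel_left]
  have hK1 : IsUnit (toCalkin (1 + K)) := by rw [← hA, h1]; exact isUnit_one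
  rw [h2, linearMap_index_mul (u.isUnit.map toCalkin) hK1, linearMap_index_of_isUnit u.isUnit,
    linearMap_index_one_add hK, add_zero]

/-- Two operators that a common `B` sends, modulo the compact operators, to invertible operators of
`L(X)` have the same index. If they are Fredholm, both indices equal `-ind B`; otherwise neither is
Fredholm and both indices are `-∞`. -/
theorem index_eq_of_left {A A' B W : X →L[ℂ] X} (hBA : toCalkin B * toCalkin A = 1)
    (hW : IsUnit W) (hBA' : toCalkin B * toCalkin A' = toCalkin W) : index A' = index A := by
  have hw : IsUnit (toCalkin W) := hW.map toCalkin
  by_cases hA : IsUnit (toCalkin A)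
  · have hB : IsUnit (toCalkin B) := by
      rw [← hA.mul_right_iff, hBA]
      exact isUnit_one
    have hA' : IsUnit (toCalkin A') := by
      rw [← hB.mul_left_iff, hBA']
      exact hw
    rw [index_eq_linearMap_index_of_isUnit hA, index_eq_linearMap_index_of_isUnit hA']
    have h1 := linearMap_index_mul hB hA
    have h2 := linearMap_index_mul hB hA'
    rw [linearMap_index_of_toCalkin_eq isUnit_one (by rw [map_mul, hBA, map_one])] at h1
    rw [linearMap_index_of_toCalkin_eq hW (by rw [map_mul, hBA'])] at h2
    rw [show LinearMap.index A'.toLinearMap = LinearMap.index A.toLinearMap by lia]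
  · have hA' : ¬ IsUnit (toCalkin A') := by
      intro hA'
      have hB : IsUnit (toCalkin B) := by
        rw [← hA'.mul_right_iff, hBA']
        exact hw
      refine hA ?_
      rw [← hB.mul_left_iff, hBA]
      exact isUnit_one
    obtain ⟨w, hw⟩ := hw
    rw [index_eq_bot_of_left ⟨_, hBA⟩ hA,
      index_eq_bot_of_left ⟨(↑w⁻¹ : Calkin X) * toCalkin B, ?_⟩ hA']
    rw [mul_assoc, hBA', ← hw, w.inv_mul]

/-- The version of `index_eq_of_left` for right inverses; the index of operators that are not
Fredholm is `+∞` here. -/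
theorem index_eq_of_right {A A' B W : X →L[ℂ] X} (hAB : toCalkin A * toCalkin B = 1)
    (hW : IsUnit W) (hAB' : toCalkin A' * toCalkin B = toCalkin W) : index A' = index A := by
  have hw : IsUnit (toCalkin W) := hW.map toCalkin
  by_cases hA : IsUnit (toCalkin A)
  · have hB : IsUnit (toCalkin B) := by
      rw [← hA.mul_left_iff, hAB]
      exact isUnit_one
    have hA' : IsUnit (toCalkin A') := by
      rw [← hB.mul_right_iff, hAB']
      exact hw
    rw [index_eq_linearMap_index_of_isUnit hA, index_eq_linearMap_index_of_isUnit hA']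
    have h1 := linearMap_index_mul hA hB
    have h2 := linearMap_index_mul hA' hB
    rw [linearMap_index_of_toCalkin_eq isUnit_one (by rw [map_mul, hAB, map_one])] at h1
    rw [linearMap_index_of_toCalkin_eq hW (by rw [map_mul, hAB'])] at h2
    rw [show LinearMap.index A'.toLinearMap = LinearMap.index A.toLinearMap by lia]
  · have hA' : ¬ IsUnit (toCalkin A') := by
      intro hA'
      have hB : IsUnit (toCalkin B) := by
        rw [← hA'.mul_left_iff, hAB']
        exact hw
      refine hA ?_
      rw [← hB.mul_right_iff, hAB]
      exact isUnit_one
    obtain ⟨w, hw⟩ := hw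
    rw [index_eq_top_of_right ⟨_, hAB⟩ hA,
      index_eq_top_of_right ⟨toCalkin B * (↑w⁻¹ : Calkin X), ?_⟩ hA']
    rw [← mul_assoc, hAB', ← hw, w.mul_inv]

theorem index_congr {A A' : X →L[ℂ] X}
    (h : HasOneSidedInverse (toCalkin A)) (hAA' : toCalkin A' = toCalkin A) :
    index A' = index A := by
  rcases h with ⟨b, hb⟩ | ⟨b, hb⟩ <;> obtain ⟨B, rfl⟩ := toCalkin_surjective b
  · exact index_eq_of_left hb isUnit_one (by rw [hAA', hb, map_one])
  · exact index_eq_of_right hb isUnit_one (by rw [hAA', hb, map_one])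

/-- One-sided invertibility modulo the compact operators and the index are both stable under small
perturbations. -/
theorem eventually_index_add_smul (A S : X →L[ℂ] X)
    (h : HasOneSidedInverse (toCalkin A)) :
    ∀ᶠ z : ℂ in 𝓝 0, HasOneSidedInverse (toCalkin (A + z • S)) ∧
      index (A + z • S) = index A := by
  have key (R : X →L[ℂ] X) : ∀ᶠ z : ℂ in 𝓝 0, IsUnit (1 + z • R) := by
    have hc : Tendsto (fun z : ℂ => 1 + z • R) (𝓝 0) (𝓝 1) := by
      have : Continuous (fun z : ℂ => 1 + z • R) := by fun_prop
      simpa using this.tendsto 0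
    exact hc.eventually (Units.isOpen.mem_nhds isUnit_one)
  rcases h with ⟨b, hb⟩ | ⟨b, hb⟩ <;> obtain ⟨B, rfl⟩ := toCalkin_surjective b
  · filter_upwards [key (B * S)] with z hz
    have h1 : toCalkin B * toCalkin (A + z • S) = toCalkin (1 + z • (B * S)) := by
      rw [map_add, mul_add, hb, ← map_mul, mul_smul_comm, map_add, map_one]
    refine ⟨Or.inl ?_, index_eq_of_left hb hz h1⟩
    obtain ⟨w, hw⟩ := hz.map toCalkin
    exact ⟨↑w⁻¹ * toCalkin B, by rw [mul_assoc, h1, ← hw, w.inv_mul]⟩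
  · filter_upwards [key (S * B)] with z hz
    have h1 : toCalkin (A + z • S) * toCalkin B = toCalkin (1 + z • (S * B)) := by
      rw [map_add, add_mul, hb, ← map_mul, smul_mul_assoc, map_add, map_one]
    refine ⟨Or.inr ?_, index_eq_of_right hb hz h1⟩
    obtain ⟨w, hw⟩ := hz.map toCalkin
    exact ⟨toCalkin B * ↑w⁻¹, by rw [← mul_assoc, h1, ← hw, w.mul_inv]⟩

theorem index_mul_of_index_eq_zero {A V : X →L[ℂ] X}
    (h : HasOneSidedInverse (toCalkin A)) (hV : IsUnit (toCalkin V))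
    (hV0 : index V = 0) :
    HasOneSidedInverse (toCalkin (A * V)) ∧
      index (A * V) = index A := by
  obtain ⟨v, hv⟩ := id hV
  have hAV : IsUnit (toCalkin (A * V)) ↔ IsUnit (toCalkin A) := by
    rw [map_mul, hV.mul_right_iff]
  have hl : (∃ b, b * toCalkin A = 1) → ∃ b, b * toCalkin (A * V) = 1 := by
    rintro ⟨b, hb⟩
    refine ⟨↑v⁻¹ * b, ?_⟩
    rw [map_mul, ← hv, mul_assoc, ← mul_assoc b, hb, one_mul, v.inv_mul]
  have hr : (∃ b, toCalkin A * b = 1) → ∃ b, toCalkin (A * V) * b = 1 := by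
    rintro ⟨b, hb⟩
    refine ⟨↑v⁻¹ * b, ?_⟩
    rw [map_mul, ← hv, mul_assoc, v.mul_inv_cancel_left, hb]
  refine ⟨Or.imp hl hr h, ?_⟩
  by_cases hA : IsUnit (toCalkin A)
  · rw [index_eq_linearMap_index_of_isUnit hA, index_eq_linearMap_index_of_isUnit (hAV.2 hA),
      linearMap_index_mul hA hV]
    rw [index_eq_linearMap_index_of_isUnit hV] at hV0
    have : LinearMap.index V.toLinearMap = 0 := by exact_mod_cast hV0
    rw [this, add_zero]
  · rcases h with h | h
    · rw [index_eq_bot_of_left h hA, index_eq_bot_of_left (hl h) (hAV.not.2 hA)]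
    · rw [index_eq_top_of_right h hA, index_eq_top_of_right (hr h) (hAV.not.2 hA)]

theorem index_of_isUnit {W : X →L[ℂ] X} (hW : IsUnit W) : index W = 0 := by
  rw [index_eq_linearMap_index_of_isUnit (hW.map toCalkin), linearMap_index_of_isUnit hW]
  simp

/-- The index is locally constant along `z ↦ 1 + z R`, and it is zero at `z = 0`. -/
theorem index_one_add_smul {R : X →L[ℂ] X} (h : ∀ z : ℂ, IsUnit (toCalkin (1 + z • R))) (z : ℂ) :
    index (1 + z • R) = 0 := by
  have hloc : IsLocallyConstant fun z : ℂ => index (1 + z • R) := by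
    rw [IsLocallyConstant.iff_eventually_eq]
    intro w
    obtain ⟨u, hu⟩ := h w
    have h1 := eventually_index_add_smul (1 + w • R) R (Or.inl ⟨↑u⁻¹, by rw [← hu, u.inv_mul]⟩)
    have h2 : Tendsto (fun z : ℂ => z - w) (𝓝 w) (𝓝 0) := by
      simpa using (continuous_sub_right w).tendsto w
    filter_upwards [h2.eventually h1] with z hz
    rw [← hz.2, add_assoc, ← add_smul, add_sub_cancel]
  rw [hloc.apply_eq_of_preconnectedSpace z 0]
  simpa using index_of_isUnit (isUnit_one (M := X →L[ℂ] X))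

end Stability

/-! ### The compression to the null space of an idempotent -/

section Compression

variable {X : Type*} [NormedAddCommGroup X] [NormedSpace ℂ X]

variable {P : X →L[ℂ] X}

theorem apply_apply_of_isIdempotentElem {Q : X →L[ℂ] X} (hQ : IsIdempotentElem Q) (x : X) :
    Q (Q x) = Q x :=
  congr($hQ.eq x)

theorem apply_one_sub_apply (hP : IsIdempotentElem P) (x : X) : P ((1 - P) x) = 0 := by
  simp [apply_apply_of_isIdempotentElem hP]

/-- The operator `(1 - P) T (1 - P) + P` of `L(X)` is the direct sum of `T₂` and the identity of
`R(P)`; it stands in for `T₂` whenever an operator on the whole space is needed. -/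
theorem ker_corner_add_le (hP : IsIdempotentElem P) (T : X →L[ℂ] X) :
    ((1 - P) * T * (1 - P) + P).ker ≤ (1 - P).range := by
  intro x hx
  have hx : (1 - P) (T ((1 - P) x)) + P x = 0 := hx
  have h1 := congrArg P hx
  rw [map_add, apply_one_sub_apply hP, apply_apply_of_isIdempotentElem hP, map_zero, zero_add] at h1
  exact ⟨x, by simp [h1]⟩

theorem ker_compression (hP : IsIdempotentElem P) (T : X →L[ℂ] X) :
    (compression (1 - P) T).ker =
      ((1 - P) * T * (1 - P) + P).ker.comap (1 - P).range.subtype := by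
  ext ⟨_, x, rfl⟩
  rw [LinearMap.mem_ker, Submodule.mem_comap, LinearMap.mem_ker, ← Subtype.coe_inj]
  change (1 - P) (T ((1 - P) ((1 - P) x))) = 0 ↔
    (1 - P) (T ((1 - P) ((1 - P) x))) + P ((1 - P) x) = 0
  rw [apply_one_sub_apply hP, add_zero]

theorem range_compression (hP : IsIdempotentElem P) (T : X →L[ℂ] X) :
    (compression (1 - P) T).range =
      ((1 - P) * T * (1 - P) + P).range.comap (1 - P).range.subtype := by
  ext y
  constructor
  · rintro ⟨⟨_, x, rfl⟩, rfl⟩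
    refine ⟨(1 - P) x, ?_⟩
    change (1 - P) (T ((1 - P) ((1 - P) x))) + P ((1 - P) x) = (1 - P) (T ((1 - P) ((1 - P) x)))
    rw [apply_one_sub_apply hP, add_zero]
  · obtain ⟨_, z, rfl⟩ := y
    rintro ⟨x, hx⟩
    have hx : (1 - P) (T ((1 - P) x)) + P x = (1 - P) z := hx
    refine ⟨⟨(1 - P) x, x, rfl⟩, Subtype.ext ?_⟩
    change (1 - P) (T ((1 - P) ((1 - P) x))) = (1 - P) z
    have h1 := congrArg P hx
    rw [map_add, apply_one_sub_apply hP, apply_one_sub_apply hP,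
      apply_apply_of_isIdempotentElem hP, zero_add] at h1
    rw [apply_apply_of_isIdempotentElem hP.one_sub, ← hx, h1, add_zero]

theorem nullity_compression (hP : IsIdempotentElem P) (T : X →L[ℂ] X) :
    nullity (compression (1 - P) T) = nullity ((1 - P) * T * (1 - P) + P) := by
  have e := (LinearEquiv.ofEq _ _ (ker_compression hP T)).trans
    (Submodule.comapSubtypeEquivOfLe (ker_corner_add_le hP T))
  exact congrArg Cardinal.toENat e.rank_eq

theorem defect_compression (hP : IsIdempotentElem P) (T : X →L[ℂ] X) :
    defect (compression (1 - P) T) = defect ((1 - P) * T * (1 - P) + P) := by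
  let U := (1 - P) * T * (1 - P) + P
  let f : (1 - P).range →ₗ[ℂ] X ⧸ U.range := U.range.mkQ ∘ₗ (1 - P).range.subtype
  have hf : Function.Surjective f := by
    intro y
    obtain ⟨x, rfl⟩ := U.range.mkQ_surjective y
    refine ⟨⟨(1 - P) x, x, rfl⟩, (Submodule.Quotient.eq _).2 ⟨-P x, ?_⟩⟩
    change (1 - P) (T ((1 - P) (-P x))) + P (-P x) = (1 - P) x - x
    simp [apply_apply_of_isIdempotentElem hP]
  have hk : (compression (1 - P) T).range = f.ker := by
    rw [range_compression hP, LinearMap.ker_comp, Submodule.ker_mkQ]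
  have e := (Submodule.quotEquivOfEq _ _ hk).trans (f.quotKerEquivOfSurjective hf)
  exact congrArg Cardinal.toENat e.rank_eq

theorem index_compression (hP : IsIdempotentElem P) (T : X →L[ℂ] X) :
    index (compression (1 - P) T) = index ((1 - P) * T * (1 - P) + P) := by
  rw [index, index, nullity_compression hP, defect_compression hP]

theorem isSemiFredholm_compression (hP : IsIdempotentElem P) (T : X →L[ℂ] X)
    (h : IsSemiFredholm ((1 - P) * T * (1 - P) + P)) :
    IsSemiFredholm (compression (1 - P) T) := by
  have hcl (hc : IsClosed (((1 - P) * T * (1 - P) + P).range : Set X)) :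
      IsClosed ((compression (1 - P) T).range : Set (1 - P).range) := by
    rw [range_compression hP]
    exact hc.preimage continuous_subtype_val
  rw [IsSemiFredholm, IsUpperSemiFredholm, IsLowerSemiFredholm, nullity_compression hP,
    defect_compression hP]
  exact h.imp (And.imp_left hcl) (And.imp_left hcl)

end Compression

/-! ### Idempotents associated to an operator -/

section Associated

theorem corner_eq {A : Type*} [Ring A] {a p : A} (hp : IsIdempotentElem p) (h : Commute a p) :
    (1 - p) * a * (1 - p) + p = a * (1 - p) + p := by
  have hp : p * p = p := hp
  have h : a * p = p * a := h
  linear_combination (norm := noncomm_ring) h - h * p + a * hp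

/-- If `b` is a left inverse of `a + p`, then `b (1 - p)` inverts `a (1 - p)` in the corner of
`1 - p`. -/
theorem corner_mul_corner_of_left {A : Type*} [Ring A] {a b p : A} (hp : IsIdempotentElem p)
    (ha : Commute a p) (h : b * (a + p) = 1) :
    (b * (1 - p) + p) * (a * (1 - p) + p) = 1 := by
  have hp : p * p = p := hp
  have ha : a * p = p * a := ha
  linear_combination (norm := noncomm_ring) h * (1 - p) +
    b * (ha - ha * p + a * hp) - (ha - ha * p + a * hp) + hp

theorem corner_mul_corner_of_right {A : Type*} [Ring A] {a b p : A} (hp : IsIdempotentElem p)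
    (hb : Commute b p) (h : (a + p) * b = 1) :
    (a * (1 - p) + p) * (b * (1 - p) + p) = 1 := by
  have hp : p * p = p := hp
  have hb : b * p = p * b := hb
  linear_combination (norm := noncomm_ring) h * (1 - p) +
    a * (hb - hb * p + b * hp) - a * hp + hp

theorem hasOneSidedInverse_corner {A : Type*} [Ring A] {a p : A} (hp : IsIdempotentElem p)
    (h : IsLeftPInvertible a p ∨ IsRightPInvertible a p ∨ IsPInvertible a p) :
    HasOneSidedInverse ((1 - p) * a * (1 - p) + p) := by
  rcases h with ⟨ha, b, hb, h⟩ | ⟨ha, b, hb, h⟩ | ⟨ha, hu⟩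
  · rw [corner_eq hp ha]
    exact Or.inl ⟨b * (1 - p) + p, corner_mul_corner_of_left hp ha h⟩
  · rw [corner_eq hp ha]
    exact Or.inr ⟨b * (1 - p) + p, corner_mul_corner_of_right hp hb h⟩
  · rw [corner_eq hp ha]
    obtain ⟨u, hu⟩ := hu
    exact Or.inl ⟨(↑u⁻¹ : A) * (1 - p) + p, corner_mul_corner_of_left hp ha (by
      rw [← hu, u.inv_mul])⟩

variable {X : Type*} [NormedAddCommGroup X] [NormedSpace ℂ X] {T P : X →L[ℂ] X}

theorem IsAssociated.isIdempotentElem (h : IsAssociated T P) : IsIdempotentElem P := by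
  rcases h with h | h | h <;> exact h.1

theorem IsAssociated.commute (h : IsAssociated T P) : Commute (toCalkin P) (toCalkin T) := by
  rcases h with h | h | h <;> exact h.2.1

theorem IsAssociated.isQuasinilpotent (h : IsAssociated T P) :
    IsQuasinilpotent (toCalkin P * toCalkin T) := by
  rcases h with h | h | h <;> exact h.2.2.1

theorem IsAssociated.hasOneSidedInverse (h : IsAssociated T P) :
    HasOneSidedInverse (toCalkin ((1 - P) * T * (1 - P) + P)) := by
  have hp : IsIdempotentElem (toCalkin P) := h.isIdempotentElem.map toCalkin
  simpa only [map_add, map_mul, map_sub, map_one] using hasOneSidedInverse_corner hp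
    (h.imp (fun h => h.2.2.2) (Or.imp (fun h => h.2.2.2) fun h => h.2.2.2))

/-- Since `Π(P)` and `Π(T)` commute, the off-diagonal entries of `T` with respect to
`X = N(P) ⊕ R(P)` are compact. -/
theorem IsAssociated.toCalkin_diagonal (h : IsAssociated T P) :
    toCalkin ((1 - P) * T * (1 - P) + P * T * P) = toCalkin T := by
  have hp : toCalkin P * toCalkin P = toCalkin P := h.isIdempotentElem.map toCalkin
  have hc : toCalkin P * toCalkin T = toCalkin T * toCalkin P := h.commute
  simp only [map_add, map_mul, map_sub, map_one]
  linear_combination (norm := noncomm_ring) 2 * hc * toCalkin P - hc + 2 * toCalkin T * hp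

theorem IsAssociated.isUnit_toCalkin_one_add_smul (h : IsAssociated T P) (z : ℂ) :
    IsUnit (toCalkin (1 + z • (P * T * P))) := by
  have hp : toCalkin P * toCalkin P = toCalkin P := h.isIdempotentElem.map toCalkin
  have hpap : toCalkin (P * T * P) = toCalkin P * toCalkin T := by
    rw [map_mul, map_mul, mul_assoc, ← h.commute.eq, ← mul_assoc, hp]
  have h1 := h.isQuasinilpotent (toCalkin (-(z • (1 : X →L[ℂ] X)))) (by
    rw [← hpap, Commute, SemiconjBy, ← map_mul, ← map_mul]
    simp)
  rw [← hpap, ← map_mul, ← map_one toCalkin, ← map_sub] at h1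
  simpa using h1

theorem isUnit_one_sub_sub_smul (hP : IsIdempotentElem P) {z : ℂ} (hz : z ≠ 0) :
    IsUnit (1 - P - z • P) := by
  refine isUnit_iff_exists.2 ⟨1 - P - z⁻¹ • P, ?_, ?_⟩ <;> ext x <;>
    simp [apply_apply_of_isIdempotentElem hP, hz]

variable [CompleteSpace X]

theorem IsAssociated.index_one_add_smul (h : IsAssociated T P) (z : ℂ) :
    index (1 + z • (P * T * P)) = 0 :=
  PseudoBFredholm.index_one_add_smul h.isUnit_toCalkin_one_add_smul z

/-- Modulo the compact operators, `T + P` is the product of `(1 - P) T (1 - P) + P` and `1 + P T P`,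
and the second factor has index zero. -/
theorem IsAssociated.add_spec (h : IsAssociated T P) :
    IsSemiFredholm (T + P) ∧ index (T + P) = index ((1 - P) * T * (1 - P) + P) := by
  obtain ⟨h1, h2⟩ := index_mul_of_index_eq_zero h.hasOneSidedInverse
    (h.isUnit_toCalkin_one_add_smul 1) (h.index_one_add_smul 1)
  have h3 : ((1 - P) * T * (1 - P) + P) * (1 + (1 : ℂ) • (P * T * P)) =
      (1 - P) * T * (1 - P) + P * T * P + P := by
    ext x
    simp [apply_apply_of_isIdempotentElem h.isIdempotentElem]
    abel
  have h4 : toCalkin (T + P) =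
      toCalkin (((1 - P) * T * (1 - P) + P) * (1 + (1 : ℂ) • (P * T * P))) := by
    rw [h3, map_add, map_add, h.toCalkin_diagonal]
  exact ⟨.of_toCalkin (h4 ▸ h1), (index_congr h1 h4).trans h2⟩

/-- Modulo the compact operators, `T - z` is the direct sum of `T₂ - z` on `N(P)`, a small
perturbation of `T₂`, and of `P (T - z) P` on `R(P)`. The latter has index zero because, with the
identity of `N(P)` added, it factors as `(1 - P - z P) (1 - z⁻¹ P T P)`. -/
theorem IsAssociated.eventually_sub_smul_spec (h : IsAssociated T P) :
    ∀ᶠ z : ℂ in 𝓝[≠] 0, IsSemiFredholm (T - z • (1 : X →L[ℂ] X)) ∧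
      index (T - z • (1 : X →L[ℂ] X)) = index (T + P) := by
  have hev := (eventually_index_add_smul ((1 - P) * T * (1 - P) + P) (-(1 - P))
    h.hasOneSidedInverse).filter_mono (nhdsWithin_le_nhds (s := {0}ᶜ))
  filter_upwards [hev, self_mem_nhdsWithin] with z ⟨hz1, hz2⟩ hz
  have hz : z ≠ 0 := hz
  have hu := isUnit_one_sub_sub_smul h.isIdempotentElem hz
  have hv := h.isUnit_toCalkin_one_add_smul (-z⁻¹)
  obtain ⟨h1, h2⟩ := index_mul_of_index_eq_zero (Or.inl (by
    obtain ⟨u, hu⟩ := hu.map toCalkin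
    exact ⟨(↑u⁻¹ : Calkin X), by rw [← hu, u.inv_mul]⟩)) hv (h.index_one_add_smul (-z⁻¹))
  rw [index_of_isUnit hu] at h2
  obtain ⟨h3, h4⟩ := index_mul_of_index_eq_zero hz1
    (by rw [map_mul]; exact (hu.map toCalkin).mul hv) h2
  have h5 : ((1 - P) * T * (1 - P) + P + z • -(1 - P)) *
      ((1 - P - z • P) * (1 + -z⁻¹ • (P * T * P))) =
      (1 - P) * T * (1 - P) + P * T * P - z • 1 := by
    ext x
    simp [apply_apply_of_isIdempotentElem h.isIdempotentElem, hz]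
    module
  have h6 : toCalkin (T - z • (1 : X →L[ℂ] X)) = toCalkin
      (((1 - P) * T * (1 - P) + P + z • -(1 - P)) *
        ((1 - P - z • P) * (1 + -z⁻¹ • (P * T * P)))) := by
    rw [h5, map_sub, map_sub, h.toCalkin_diagonal]
  refine ⟨.of_toCalkin (h6 ▸ h3), ?_⟩
  rw [index_congr h3 h6, h4, hz2, h.add_spec.2]

theorem IsAssociated.tendsto_index (h : IsAssociated T P) :
    Tendsto (fun z : ℂ => index (T - z • (1 : X →L[ℂ] X))) (𝓝[≠] 0) (𝓝 (index (T + P))) :=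
  tendsto_const_nhds.congr' (h.eventually_sub_smul_spec.mono fun _ hz => hz.2.symm)

end Associated

end PseudoBFredholm

theorem theorem4p2 {X : Type*} [NormedAddCommGroup X] [NormedSpace ℂ X] [CompleteSpace X]
    (T : X →L[ℂ] X) (hT : PseudoBFredholm.IsPseudoSemiBFredholm T) :
    -- for every associated `P`, `T + P` and `T₂` are semi-Fredholm, with the same index
    (∀ P : X →L[ℂ] X, PseudoBFredholm.IsAssociated T P →
      PseudoBFredholm.IsSemiFredholm (T + P) ∧
      PseudoBFredholm.IsSemiFredholm (PseudoBFredholm.compression (1 - P) T) ∧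
      PseudoBFredholm.index (T + P) =
        PseudoBFredholm.index (PseudoBFredholm.compression (1 - P) T) ∧
      (PseudoBFredholm.defect (PseudoBFredholm.compression (1 - P) T) = ⊤ →
        PseudoBFredholm.index (T + P) = ⊥) ∧
      (PseudoBFredholm.nullity (PseudoBFredholm.compression (1 - P) T) = ⊤ →
        PseudoBFredholm.index (T + P) = ⊤)) ∧
    -- `ind(T) := ind(T + P)` is well defined
    (∃! i : EReal, ∃ P : X →L[ℂ] X,
      PseudoBFredholm.IsAssociated T P ∧ PseudoBFredholm.index (T + P) = i) ∧
    -- `ind(T)` is the limit of `ind(T - λI)` as `λ → 0`, `λ ≠ 0`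
    (∀ᶠ z : ℂ in 𝓝[≠] 0, PseudoBFredholm.IsSemiFredholm (T - z • (1 : X →L[ℂ] X))) ∧
    (∀ P : X →L[ℂ] X, PseudoBFredholm.IsAssociated T P →
      Tendsto (fun z : ℂ => PseudoBFredholm.index (T - z • (1 : X →L[ℂ] X)))
        (𝓝[≠] 0) (𝓝 (PseudoBFredholm.index (T + P)))) := by
  obtain ⟨P₀, hP₀⟩ : ∃ P, PseudoBFredholm.IsAssociated T P :=
    hT.elim (fun ⟨P, h⟩ => ⟨P, .inl h⟩) fun ⟨P, h⟩ => ⟨P, .inr (.inl h)⟩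
  refine ⟨fun P hP => ?_, ⟨_, ⟨P₀, hP₀, rfl⟩, ?_⟩,
    hP₀.eventually_sub_smul_spec.mono fun _ hz => hz.1, fun P hP => hP.tendsto_index⟩
  · obtain ⟨h1, h2⟩ := hP.add_spec
    have h3 := PseudoBFredholm.isSemiFredholm_compression hP.isIdempotentElem T
      (.of_toCalkin hP.hasOneSidedInverse)
    have h4 := h2.trans (PseudoBFredholm.index_compression hP.isIdempotentElem T).symm
    refine ⟨h1, h3, h4, fun hd => h4.trans (PseudoBFredholm.index_eq_bot hd), fun hn => ?_⟩
    exact h4.trans (PseudoBFredholm.index_eq_top hn (h3.resolve_left fun h => h.2 hn).2)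
  · rintro _ ⟨P, hP, rfl⟩
    exact tendsto_nhds_unique hP.tendsto_index hP₀.tendsto_index
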